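/- A subshift over a finite alphabet $\mathcal A$ is a closed set $X\subset\mathcal A^{\mathbb Z}$ invariant under the left shift $\sigma$, $(\sigma x)(k)=x(k+1)$, and its inverse; $P_X(n)$ denotes the number of words of length $n$ occurring in points of $X$. A Sturmian shift is a minimal subshift $Y\subset\{0,1\}^{\mathbb Z}$ (every orbit $\{\sigma^k y: k\in\mathbb Z\}$, $y\in Y$, is dense in $Y$) with $P_Y(n)=n+1$ for all $n$. Let $(p_n)_{n\ge 1}$ be a sequence of real numbers with $$\liminf_{n\to\infty}\frac{p_n}{n}=\infty .$$ Then there exists a subshift $X\subset\{0,1\}^{\mathbb Z}$ such that $(X,\sigma)$ has infinitely many nonatomic ergodic Borel probability measures and $P_X(n)\le p_n$ for all but finitely many $n$. Moreover, $X$ can be chosen to be the closure of a union of Sturmian shifts. -/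

import Mathlib

open Filter MeasureTheory
open SymbolicDynamics.FullShift

namespace SymbolicSubshift

/-- The words of length `n` in the language of a two-sided subshift `X`: those that occur, at
some position, in some point of `X`. -/
def words {A : Type*} [TopologicalSpace A] (X : Subshift A ℤ) (n : ℕ) : Set (Fin n → A) :=
  {w | ∃ x ∈ X.carrier, ∃ m : ℤ, ∀ i : Fin n, x (m + (i : ℤ)) = w i}

/-- The complexity function: the number of words of length `n` in the language of `X`
(a finite number, since the alphabet is finite). -/
noncomputable def complexity {A : Type*} [Finite A] [TopologicalSpace A] (X : Subshift A ℤ)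
    (n : ℕ) : ℕ :=
  (words X n).ncard

/-- A subshift is minimal if every point has a dense orbit. -/
def IsMinimal {A : Type*} [TopologicalSpace A] (X : Subshift A ℤ) : Prop :=
  ∀ x ∈ X.carrier, closure (Set.range fun k : ℤ => shift k x) = X.carrier

/-- A Sturmian shift: a minimal subshift on two letters with exactly `n + 1` words of each
length `n`. -/
def IsSturmian (Y : Subshift (Fin 2) ℤ) : Prop :=
  IsMinimal Y ∧ ∀ n : ℕ, complexity Y n = n + 1

/-- `μ` is an ergodic measure of the subshift `X`: a probability measure carried by `X`, invariant
and ergodic for the left shift `(σ x) k = x (1 + k)`. -/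
def IsErgodicMeasure {A : Type*} [TopologicalSpace A] [MeasurableSpace A] (X : Subshift A ℤ)
    (μ : Measure (ℤ → A)) : Prop :=
  IsProbabilityMeasure μ ∧ μ X.carrierᶜ = 0 ∧ Ergodic (shift (1 : ℤ)) μ

end SymbolicSubshift

namespace SymbolicSubshift

/-! Sturmian shifts are built as codings of rotations by irrational slopes `a k` that tend to 0
fast. Each has n + 1 words of length n and carries the image of Lebesgue measure, which is ergodic
and nonatomic; the cylinder of the letter 1 at time 0 has mass `a k`, so these measures are
distinct. When n * a k ≤ 1, a word of length n has at most one letter 1, so all such k together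
contribute at most n + 1 words. If this holds for every k ≥ K, the closure of the union has at most
(K + 1)(n + 1) words. Since p n / n → ∞, K may grow with n, and the slopes are chosen so small that
it grows slowly enough for p. -/

open Set Topology

/-! ### Closures of shift-invariant sets -/

section Closure

variable {A : Type*} [TopologicalSpace A] [DiscreteTopology A]

/-- A configuration lies in the closure of `O` iff each of its central windows occurs in place in
some point of `O`. -/
theorem mem_closure_iff_window {O : Set (ℤ → A)} {x : ℤ → A} :
    x ∈ closure O ↔ ∀ N : ℕ, ∃ y ∈ O, ∀ k : ℤ, k.natAbs ≤ N → y k = x k := by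
  constructor
  · intro hx N
    obtain ⟨y, hy, hyO⟩ := mem_closure_iff.1 hx _
      (isOpen_cylinder (Finset.Icc (-(N : ℤ)) N) x) (fun _ _ => rfl)
    exact ⟨y, hyO, fun k hk => hy k (by simp only [Finset.mem_Icc]; omega)⟩
  · intro h
    rw [mem_closure_iff]
    intro U hU hxU
    obtain ⟨I, u, hu, hIU⟩ := isOpen_pi_iff.1 hU x hxU
    obtain ⟨y, hyO, hy⟩ := h (I.sup Int.natAbs)
    refine ⟨y, hIU fun k hk => ?_, hyO⟩
    rw [hy k (Finset.le_sup (f := Int.natAbs) hk)]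
    exact (hu k hk).2

/-- The subshift obtained as the closure of a shift-invariant set. -/
def closureSubshift (O : Set (ℤ → A)) (hO : ∀ g : ℤ, MapsTo (shift g) O O) : Subshift A ℤ where
  carrier := closure O
  isClosed := isClosed_closure
  mapsTo g := (hO g).closure (continuous_shift g)

theorem exists_word_of_mem_closure {O : Set (ℤ → A)} {x : ℤ → A} (hx : x ∈ closure O)
    (m : ℤ) (n : ℕ) : ∃ y ∈ O, ∀ i : Fin n, y (m + (i : ℤ)) = x (m + (i : ℤ)) := by
  obtain ⟨y, hy, h⟩ := mem_closure_iff_window.1 hx (m.natAbs + n)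
  exact ⟨y, hy, fun i => h _ (by have := i.2; omega)⟩

end Closure

/-! ### Codings of rotations and minimality -/

/-- The coding of the orbit of `t` under the rotation by `a`: the `k`-th letter is `1` iff an
integer is crossed between `t + k * a` and `t + (k + 1) * a`. -/
noncomputable def coding (a t : ℝ) (k : ℤ) : Fin 2 :=
  if ⌊t + ((k + 1 : ℤ) : ℝ) * a⌋ = ⌊t + (k : ℝ) * a⌋ then 0 else 1

theorem shift_coding (a t : ℝ) (m : ℤ) : shift m (coding a t) = coding a (t + m * a) := by
  funext k
  simp only [shift_apply, coding]
  push_cast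
  ring_nf

theorem coding_add_one (a t : ℝ) : coding a (t + 1) = coding a t := by
  funext k
  have h (s : ℝ) : ⌊t + 1 + s⌋ = ⌊t + s⌋ + 1 := by
    rw [← Int.floor_add_one]; ring_nf
  simp only [coding, h, add_left_inj]

theorem coding_add_int (a t : ℝ) (j : ℤ) : coding a (t + j) = coding a t := by
  have h : Function.Periodic (coding a) 1 := coding_add_one a
  simpa using h.int_mul j t

theorem floor_succ_eq {a : ℝ} (ha : a ∈ Ioo (0 : ℝ) 1) (t : ℝ) (k : ℤ) :
    ⌊t + ((k + 1 : ℤ) : ℝ) * a⌋ = ⌊t + (k : ℝ) * a⌋ + ((coding a t k : Fin 2) : ℕ) := by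
  have h1 : ⌊t + (k : ℝ) * a⌋ ≤ ⌊t + ((k + 1 : ℤ) : ℝ) * a⌋ := by
    apply Int.floor_mono; push_cast; nlinarith [ha.1]
  have h2 : ⌊t + ((k + 1 : ℤ) : ℝ) * a⌋ ≤ ⌊t + (k : ℝ) * a⌋ + 1 := by
    rw [← Int.floor_add_one]
    apply Int.floor_mono; push_cast; nlinarith [ha.2]
  unfold coding
  split_ifs with h
  · rw [h]; simp
  · simp only [Fin.val_one, Nat.cast_one]; omega

theorem coding_eq_iff {a : ℝ} (ha : a ∈ Ioo (0 : ℝ) 1) (s t : ℝ) (k : ℤ) :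
    coding a s k = coding a t k ↔
      ⌊s + ((k + 1 : ℤ) : ℝ) * a⌋ - ⌊s + (k : ℝ) * a⌋ =
        ⌊t + ((k + 1 : ℤ) : ℝ) * a⌋ - ⌊t + (k : ℝ) * a⌋ := by
  rw [floor_succ_eq ha, floor_succ_eq ha, Fin.ext_iff]
  omega

/-- The floors of the orbit are determined by the coding, from any starting time on. -/
theorem floor_eq_of_coding_eq {a : ℝ} (ha : a ∈ Ioo (0 : ℝ) 1) {s t : ℝ} {m : ℤ}
    (h0 : ⌊s + (m : ℝ) * a⌋ = ⌊t + (m : ℝ) * a⌋) {n : ℕ}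
    (h : ∀ i < n, coding a s (m + i) = coding a t (m + i)) :
    ⌊s + ((m + n : ℤ) : ℝ) * a⌋ = ⌊t + ((m + n : ℤ) : ℝ) * a⌋ := by
  induction n with
  | zero => simpa using h0
  | succ n ih =>
    have h1 := ih fun i hi => h i (by omega)
    have h2 := (coding_eq_iff ha s t (m + n)).1 (h n (by omega))
    rw [show m + ((n + 1 : ℕ) : ℤ) = m + n + 1 by push_cast; ring]
    omega

/-- Bounded gaps for the rotation by an irrational number. -/
theorem exists_bounded_gap {a : ℝ} (ha : Irrational a) {u v : ℝ} (huv : u < v) :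
    ∃ L : ℕ, ∀ t : ℝ, ∃ m j : ℤ, m.natAbs ≤ L ∧ t + m * a + j ∈ Ioo u v := by
  have hd : Dense (AddSubgroup.closure {a, 1} : Set ℝ) :=
    dense_addSubgroupClosure_pair_iff.2 (by simpa using ha)
  let U : ℤ × ℤ → Set ℝ := fun q => {t | t + q.1 * a + q.2 ∈ Ioo u v}
  have hU : ∀ q, IsOpen (U q) := fun q =>
    isOpen_Ioo.preimage (by fun_prop : Continuous fun t : ℝ => t + q.1 * a + q.2)
  have hcov : Icc (0 : ℝ) 1 ⊆ ⋃ q, U q := by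
    intro t _
    obtain ⟨y, hy, hyI⟩ := hd.exists_mem_open (isOpen_Ioo (a := u - t) (b := v - t))
      (nonempty_Ioo.2 (by linarith))
    obtain ⟨m, j, rfl⟩ := AddSubgroup.mem_closure_pair.1 hy
    simp only [zsmul_eq_mul, mul_one, mem_Ioo] at hyI
    exact mem_iUnion.2 ⟨(m, j), by constructor <;> simp only <;> linarith [hyI.1, hyI.2]⟩
  obtain ⟨F, hF⟩ := isCompact_Icc.elim_finite_subcover U hU hcov
  refine ⟨F.sup fun q => q.1.natAbs, fun t => ?_⟩
  obtain ⟨q, hq, htq⟩ := mem_iUnion₂.1 (hF ⟨Int.fract_nonneg t, (Int.fract_lt_one t).le⟩)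
  refine ⟨q.1, q.2 - ⌊t⌋, Finset.le_sup (f := fun q : ℤ × ℤ => q.1.natAbs) hq, ?_⟩
  have : Int.fract t + q.1 * a + q.2 ∈ Ioo u v := htq
  rw [Int.fract] at this
  push_cast
  convert this using 1
  ring

/-- Codings are locally constant to the right on finite windows. -/
theorem exists_coding_eq_right (a t : ℝ) (N : ℕ) :
    ∃ u > t, ∀ s ∈ Ioo t u, ∀ k : ℤ, k.natAbs ≤ N → coding a s k = coding a t k := by
  -- The floor is only right-continuous, hence the one-sided neighbourhood.
  have h (y : ℝ) : ∀ᶠ s in 𝓝[>] t, ⌊s + y⌋ = ⌊t + y⌋ := by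
    have h1 : Tendsto (fun s : ℝ => s + y) (𝓝[>] t) (𝓝[≥] (t + y)) := by
      refine tendsto_nhdsWithin_iff.2 ⟨?_, ?_⟩
      · exact ((continuous_id.add continuous_const).tendsto t).mono_left nhdsWithin_le_nhds
      · filter_upwards [self_mem_nhdsWithin] with s hs
        have : t < s := hs
        simp only [mem_Ici]; linarith
    have := (tendsto_floor_right_pure_floor (t + y)).comp h1
    simpa using this
  have h2 : ∀ᶠ s in 𝓝[>] t, ∀ k ∈ Finset.Icc (-(N : ℤ)) N, coding a s k = coding a t k := by
    rw [Filter.eventually_all_finset]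
    intro k _
    filter_upwards [h (((k + 1 : ℤ) : ℝ) * a), h ((k : ℝ) * a)] with s h3 h4
    simp only [coding, h3, h4]
  obtain ⟨u, hu, hs⟩ := mem_nhdsGT_iff_exists_Ioo_subset.1 h2
  exact ⟨u, hu, fun s hsu k hk => hs hsu k (by simp only [Finset.mem_Icc]; omega)⟩

/-- The subshift generated by the codings of the rotation by `a`. -/
noncomputable def rotationSubshift (a : ℝ) : Subshift (Fin 2) ℤ :=
  closureSubshift (range (coding a)) (by
    rintro g _ ⟨t, rfl⟩
    exact ⟨_, (shift_coding a t g).symm⟩)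

theorem coding_mem (a t : ℝ) : coding a t ∈ (rotationSubshift a).carrier :=
  subset_closure ⟨t, rfl⟩

theorem isMinimal_rotationSubshift {a : ℝ} (ha : Irrational a) :
    IsMinimal (rotationSubshift a) := by
  intro x hx
  apply subset_antisymm
  · refine closure_minimal ?_ (rotationSubshift a).isClosed
    rintro _ ⟨k, rfl⟩
    exact (rotationSubshift a).mapsTo k hx
  · refine closure_minimal ?_ isClosed_closure
    rintro _ ⟨t, rfl⟩
    rw [mem_closure_iff_window]
    intro N
    obtain ⟨u, htu, hu⟩ := exists_coding_eq_right a t N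
    obtain ⟨L, hL⟩ := exists_bounded_gap ha htu
    -- The radius L + N leaves room for a window of radius N shifted by a return time at most L.
    obtain ⟨_, ⟨s, rfl⟩, hs⟩ := mem_closure_iff_window.1 hx (L + N)
    obtain ⟨m, j, hm, hmj⟩ := hL s
    refine ⟨_, ⟨m, rfl⟩, fun k hk => ?_⟩
    change x (m + k) = _
    rw [← hs _ (by omega), ← hu _ hmj k hk, coding_add_int, ← shift_coding,
      shift_apply]

/-! ### Counting words -/

/-- The word of length `n` read from time `0` in the coding of `t`. -/
noncomputable def codingWord (a : ℝ) (n : ℕ) (t : ℝ) : Fin n → Fin 2 := fun i => coding a t (i : ℤ)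

theorem words_rotationSubshift (a : ℝ) (n : ℕ) :
    words (rotationSubshift a) n = codingWord a n '' Ico 0 1 := by
  ext w
  constructor
  · rintro ⟨x, hx, m, hw⟩
    obtain ⟨_, ⟨t, rfl⟩, ht⟩ := exists_word_of_mem_closure hx m n
    refine ⟨Int.fract (t + m * a), ⟨Int.fract_nonneg _, Int.fract_lt_one _⟩, ?_⟩
    funext i
    rw [← hw i, ← ht i, codingWord, Int.fract, sub_eq_add_neg, ← Int.cast_neg, coding_add_int,
      ← shift_coding, shift_apply]
  · rintro ⟨t, -, rfl⟩
    exact ⟨_, coding_mem a t, 0, fun i => by simp [codingWord]⟩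

/-- On [0, 1) the floor of t + y jumps just once, at the fractional part of -y. -/
theorem floor_add_eq_ite {t : ℝ} (ht : t ∈ Ico (0 : ℝ) 1) (y : ℝ) :
    ⌊t + y⌋ = -⌊-y⌋ - if Int.fract (-y) ≤ t then 0 else 1 := by
  have h1 := Int.floor_add_fract (-y)
  have h2 := Int.fract_nonneg (-y)
  have h3 := Int.fract_lt_one (-y)
  rw [Int.floor_eq_iff]
  split_ifs <;> push_cast <;> constructor <;> linarith [ht.1, ht.2]

/-- The word and the n + 1 floors of t + i * a, i ≤ n, determine each other, since the floor at i =
0 is 0. -/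
theorem codingWord_eq_iff {a : ℝ} (ha : a ∈ Ioo (0 : ℝ) 1) {n : ℕ} {s t : ℝ}
    (hs : s ∈ Ico (0 : ℝ) 1) (ht : t ∈ Ico (0 : ℝ) 1) :
    codingWord a n s = codingWord a n t ↔
      ∀ i ≤ n, (Int.fract (-((i : ℝ) * a)) ≤ s ↔ Int.fract (-((i : ℝ) * a)) ≤ t) := by
  have key (i : ℕ) : ⌊s + (i : ℝ) * a⌋ = ⌊t + (i : ℝ) * a⌋ ↔
      (Int.fract (-((i : ℝ) * a)) ≤ s ↔ Int.fract (-((i : ℝ) * a)) ≤ t) := by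
    rw [floor_add_eq_ite hs, floor_add_eq_ite ht]
    rw [sub_right_inj]
    split_ifs with h1 h2 h2 <;> simp [h1, h2]
  simp only [← key]
  constructor
  · intro h i hi
    have h0 : ⌊s + ((0 : ℤ) : ℝ) * a⌋ = ⌊t + ((0 : ℤ) : ℝ) * a⌋ := by
      simp [Int.floor_eq_zero_iff.2 hs, Int.floor_eq_zero_iff.2 ht]
    have := floor_eq_of_coding_eq ha h0 (n := i) fun l hl => by
      simpa [codingWord] using congrFun h ⟨l, by omega⟩
    simpa using this
  · intro h
    funext i
    have h1 := h (i + 1) (by omega)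
    have h2 := h i (by omega)
    refine (coding_eq_iff ha s t i).2 ?_
    push_cast at h1 ⊢
    rw [h1, h2]

theorem fract_neg_mul_injective {a : ℝ} (ha : Irrational a) :
    Function.Injective fun i : ℕ => Int.fract (-((i : ℝ) * a)) := by
  intro i j hij
  by_contra hne
  obtain ⟨z, hz⟩ := Int.fract_eq_fract.1 hij
  have hij' : ((i : ℤ) - j) ≠ 0 := by omega
  refine (ha.intCast_mul hij').ne_int (-z) ?_
  push_cast
  linarith

/-- The n + 1 distinct breakpoints, 0 among them, cut [0, 1) into n + 1 intervals, one for each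
word. -/
theorem complexity_rotationSubshift {a : ℝ} (ha : a ∈ Ioo (0 : ℝ) 1) (hirr : Irrational a)
    (n : ℕ) : complexity (rotationSubshift a) n = n + 1 := by
  classical
  set f : ℕ → ℝ := fun i => Int.fract (-((i : ℝ) * a)) with hf
  let T : Finset ℝ := (Finset.range (n + 1)).image f
  have hfT {i : ℕ} (hi : i ≤ n) : f i ∈ T := Finset.mem_image_of_mem _ (by simp; omega)
  have hT : ∀ s ∈ T, s ∈ Ico (0 : ℝ) 1 ∧ ∃ i ≤ n, f i = s := by
    intro s hs
    obtain ⟨i, hi, rfl⟩ := Finset.mem_image.1 hs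
    exact ⟨⟨Int.fract_nonneg _, Int.fract_lt_one _⟩, i, by simp at hi; omega, rfl⟩
  have hf0 : f 0 = 0 := by simp [hf]
  have himage : codingWord a n '' Ico 0 1 = codingWord a n '' (T : Set ℝ) := by
    apply subset_antisymm
    · rintro _ ⟨t, ht, rfl⟩
      -- The left endpoint of the interval of t, its largest breakpoint ≤ t, has the same word.
      have hne : (T.filter (· ≤ t)).Nonempty :=
        ⟨f 0, Finset.mem_filter.2 ⟨hfT (Nat.zero_le n), by rw [hf0]; exact ht.1⟩⟩
      have hmem := Finset.mem_filter.1 (Finset.max'_mem _ hne)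
      refine ⟨_, hmem.1, (codingWord_eq_iff ha (hT _ hmem.1).1 ht).2 fun i hi => ?_⟩
      exact ⟨fun h => h.trans hmem.2,
        fun h => Finset.le_max' _ _ (Finset.mem_filter.2 ⟨hfT hi, h⟩)⟩
    · exact image_mono fun s hs => (hT s hs).1
  have hinj : InjOn (codingWord a n) (T : Set ℝ) := by
    intro s hs t ht hst
    rw [codingWord_eq_iff ha (hT s hs).1 (hT t ht).1] at hst
    obtain ⟨i, hi, rfl⟩ := (hT s hs).2
    obtain ⟨j, hj, rfl⟩ := (hT t ht).2
    exact le_antisymm ((hst i hi).1 le_rfl) ((hst j hj).2 le_rfl)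
  rw [complexity, words_rotationSubshift, himage, hinj.ncard_image, ncard_coe_finset,
    Finset.card_image_of_injective _ (fract_neg_mul_injective hirr), Finset.card_range]

theorem isSturmian_rotationSubshift {a : ℝ} (ha : a ∈ Ioo (0 : ℝ) 1) (hirr : Irrational a) :
    IsSturmian (rotationSubshift a) :=
  ⟨isMinimal_rotationSubshift hirr, complexity_rotationSubshift ha hirr⟩

/-- The words of length `n` containing at most one letter `1`. -/
def sparseWords (n : ℕ) : Set (Fin n → Fin 2) :=
  insert 0 (range fun i : Fin n => Pi.single i 1)

theorem ncard_sparseWords_le (n : ℕ) : (sparseWords n).ncard ≤ n + 1 := by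
  refine (ncard_insert_le _ _).trans (Nat.add_le_add_right ?_ 1)
  rw [← image_univ]
  refine (ncard_image_le finite_univ).trans ?_
  simp [ncard_univ]

/-- The orbit travels n * a ≤ 1 during the word, so it crosses at most one integer. -/
theorem words_subset_sparseWords {a : ℝ} (ha : a ∈ Ioo (0 : ℝ) 1) {n : ℕ} (hn : n * a ≤ 1) :
    words (rotationSubshift a) n ⊆ sparseWords n := by
  rw [words_rotationSubshift]
  rintro _ ⟨t, -, rfl⟩
  have hmono {k l : ℤ} (h : k ≤ l) : ⌊t + (k : ℝ) * a⌋ ≤ ⌊t + (l : ℝ) * a⌋ := by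
    have : (k : ℝ) ≤ l := by exact_mod_cast h
    apply Int.floor_mono; nlinarith [ha.1]
  have hend : ⌊t + ((n : ℤ) : ℝ) * a⌋ ≤ ⌊t + ((0 : ℤ) : ℝ) * a⌋ + 1 := by
    rw [← Int.floor_add_one]
    apply Int.floor_mono; push_cast; linarith
  have huniq {i j : Fin n} (hij : i < j) (hi : codingWord a n t i = 1) :
      codingWord a n t j ≠ 1 := by
    intro hj
    have h1 := floor_succ_eq ha t i
    have h2 := floor_succ_eq ha t j
    have hi' : coding a t i = 1 := hi
    have hj' : coding a t j = 1 := hj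
    rw [hi'] at h1
    rw [hj'] at h2
    simp only [Fin.val_one, Nat.cast_one] at h1 h2
    have h3 := hmono (k := (i : ℤ) + 1) (l := j) (by omega)
    have h4 := hmono (k := (j : ℤ) + 1) (l := n) (by omega)
    have h5 := hmono (k := 0) (l := (i : ℤ)) (by omega)
    omega
  by_cases h : ∃ i, codingWord a n t i = 1
  · obtain ⟨i, hi⟩ := h
    refine Or.inr ⟨i, ?_⟩
    funext j
    by_cases hji : j = i
    · subst hji; simp [hi]
    · have : codingWord a n t j ≠ 1 := by
        rcases lt_or_gt_of_ne hji with h | h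
        · exact fun hj => huniq h hj hi
        · exact huniq h hi
      simp only [Pi.single_eq_of_ne hji]
      omega
  · push Not at h
    refine Or.inl ?_
    funext j
    have := h j
    simp only [Pi.zero_apply]
    omega

/-! ### Ergodic nonatomic measures -/

theorem measurable_coding (a : ℝ) : Measurable (coding a) := by
  refine measurable_pi_lambda _ fun k => ?_
  refine Measurable.ite (measurableSet_eq_fun ?_ ?_) measurable_const measurable_const <;>
  exact Int.measurable_floor.comp (by fun_prop)

/-- The distribution of the coding of a uniformly distributed point of the circle. -/
noncomputable def rotationMeasure (a : ℝ) : Measure (ℤ → Fin 2) :=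
  (volume.restrict (Ico (0 : ℝ) 1)).map (coding a)

theorem rotationMeasure_apply (a : ℝ) {s : Set (ℤ → Fin 2)} (hs : MeasurableSet s) :
    rotationMeasure a s = volume (coding a ⁻¹' s ∩ Ico 0 1) := by
  rw [rotationMeasure, Measure.map_apply (measurable_coding a) hs,
    Measure.restrict_apply (measurable_coding a hs)]

theorem isProbabilityMeasure_rotationMeasure (a : ℝ) :
    IsProbabilityMeasure (rotationMeasure a) :=
  ⟨by rw [rotationMeasure_apply a .univ]; simp⟩

/-- The coding is a factor map from the irrational rotation of the circle, which is ergodic. -/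
theorem ergodic_rotationMeasure {a : ℝ} (ha : Irrational a) :
    Ergodic (shift (1 : ℤ)) (rotationMeasure a) := by
  have hper : Function.Periodic (coding a) 1 := coding_add_one a
  let C : UnitAddCircle → (ℤ → Fin 2) := hper.lift
  have hC (t : ℝ) : C (t : UnitAddCircle) = coding a t := hper.lift_coe t
  have hmeas : Measurable C := by
    have : C = fun x => coding a ((AddCircle.measurableEquivIco 1 0 x : Ico (0 : ℝ) (0 + 1)) : ℝ) := by
      funext x
      rw [← hC]
      exact congrArg C ((AddCircle.equivIco 1 0).symm_apply_apply x).symm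
    rw [this]
    exact (measurable_coding a).comp
      (measurable_subtype_coe.comp (AddCircle.measurableEquivIco 1 0).measurable)
  have hmap : MeasurePreserving C volume (rotationMeasure a) := by
    refine ⟨hmeas, ?_⟩
    have hmk := UnitAddCircle.measurePreserving_mk 0
    rw [← hmk.map_eq, Measure.map_map hmeas hmk.measurable, rotationMeasure,
      restrict_Ico_eq_restrict_Ioc, zero_add]
    rfl
  have herg : Ergodic (· + (a : UnitAddCircle)) := by
    rw [AddCircle.ergodic_add_right, ← AddCircle.denseRange_zsmul_iff,
      AddCircle.denseRange_zsmul_coe_iff]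
    simpa using ha
  refine hmap.ergodic_of_ergodic_semiconj herg (continuous_shift 1).measurable fun x => ?_
  induction x using QuotientAddGroup.induction_on with
  | H t =>
    rw [hC, shift_coding, Int.cast_one, one_mul, ← hC]
    rfl

theorem nullSingletonClass_rotationMeasure {a : ℝ} (ha : a ∈ Ioo (0 : ℝ) 1)
    (hirr : Irrational a) : NullSingletonClass (rotationMeasure a) := by
  refine ⟨fun x => ?_⟩
  rw [rotationMeasure_apply a (measurableSet_singleton x)]
  refine Set.Subsingleton.measure_zero ?_ _
  have key {s t : ℝ} (hs : s ∈ Ico (0 : ℝ) 1) (ht : t ∈ Ico (0 : ℝ) 1)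
      (hst : coding a s = coding a t) : ¬ s < t := by
    intro hlt
    -- A time m with m * a + j in (-t, -s) puts an integer between the two orbits, although equal
    -- codings force equal floors.
    obtain ⟨L, hL⟩ := exists_bounded_gap hirr (neg_lt_neg hlt)
    obtain ⟨m, j, -, hmj⟩ := hL 0
    have hfl : ⌊s + (m : ℝ) * a⌋ = ⌊t + (m : ℝ) * a⌋ := by
      have h0 : ⌊s + ((0 : ℤ) : ℝ) * a⌋ = ⌊t + ((0 : ℤ) : ℝ) * a⌋ := by
        simp [Int.floor_eq_zero_iff.2 hs, Int.floor_eq_zero_iff.2 ht]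
      have hsum (k : ℤ) : ⌊s + (k : ℝ) * a⌋ = ⌊t + (k : ℝ) * a⌋ := by
        induction k using Int.induction_on with
        | zero => exact h0
        | succ i ih =>
          have := (coding_eq_iff ha s t i).1 (congrFun hst i)
          omega
        | pred i ih =>
          have := (coding_eq_iff ha s t (-i - 1)).1 (congrFun hst _)
          rw [show (-(i : ℤ) - 1 + 1) = -i by ring] at this
          omega
      exact hsum m
    have h1 : ⌊s + (m : ℝ) * a⌋ < -j := by
      rw [Int.floor_lt]; push_cast; linarith [hmj.2]
    have h2 : -j ≤ ⌊t + (m : ℝ) * a⌋ := by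
      rw [Int.le_floor]; push_cast; linarith [hmj.1]
    omega
  rintro s ⟨hs, hs'⟩ t ⟨ht, ht'⟩
  have hst : coding a s = coding a t := Eq.trans hs (Eq.symm ht)
  exact le_antisymm (not_lt.1 (key ht' hs' hst.symm)) (not_lt.1 (key hs' ht' hst))

theorem rotationMeasure_one {a : ℝ} (ha : a ∈ Ioo (0 : ℝ) 1) :
    rotationMeasure a {x | x 0 = 1} = ENNReal.ofReal a := by
  have hmeas : MeasurableSet {x : ℤ → Fin 2 | x 0 = 1} :=
    measurable_pi_apply (0 : ℤ) (measurableSet_singleton 1)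
  have : coding a ⁻¹' {x | x 0 = 1} ∩ Ico 0 1 = Ico (1 - a) 1 := by
    ext t
    simp only [mem_inter_iff, mem_preimage, mem_ofPred_eq, mem_Ico, coding]
    constructor
    · rintro ⟨h, h0, h1⟩
      refine ⟨?_, h1⟩
      by_contra hlt
      have e1 : ⌊t⌋ = 0 := Int.floor_eq_zero_iff.2 ⟨h0, h1⟩
      have e2 : ⌊t + a⌋ = 0 := Int.floor_eq_zero_iff.2 ⟨by linarith [ha.1], by linarith⟩
      simp [e1, e2] at h
    · rintro ⟨h0, h1⟩
      have h2 : 0 ≤ t := by linarith [ha.2]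
      refine ⟨?_, h2, h1⟩
      have e1 : ⌊t⌋ = 0 := Int.floor_eq_zero_iff.2 ⟨h2, h1⟩
      have e2 : 1 ≤ ⌊t + a⌋ := by rw [Int.le_floor]; push_cast; linarith
      have e3 : ⌊t + a⌋ ≠ 0 := by omega
      simp [e1, e3]
  rw [rotationMeasure_apply a hmeas, this, Real.volume_Ico]
  congr 1
  ring

theorem isErgodicMeasure_rotationMeasure {a : ℝ} (hirr : Irrational a) {X : Subshift (Fin 2) ℤ}
    (hX : (rotationSubshift a).carrier ⊆ X.carrier) :
    IsErgodicMeasure X (rotationMeasure a) := by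
  refine ⟨isProbabilityMeasure_rotationMeasure a, ?_, ergodic_rotationMeasure hirr⟩
  rw [rotationMeasure_apply a X.isClosed.measurableSet.compl]
  convert measure_empty (μ := (volume : Measure ℝ))
  ext t
  simp [hX (coding_mem a t)]

/-! ### The union and its complexity -/

/-- The closure of the union of the rotation subshifts of slopes `a k`. -/
noncomputable def unionSubshift (a : ℕ → ℝ) : Subshift (Fin 2) ℤ :=
  closureSubshift (⋃ k, (rotationSubshift (a k)).carrier) fun g x hx => by
    obtain ⟨k, hk⟩ := mem_iUnion.1 hx
    exact mem_iUnion.2 ⟨k, (rotationSubshift (a k)).mapsTo g hk⟩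

theorem rotationSubshift_subset_unionSubshift (a : ℕ → ℝ) (k : ℕ) :
    (rotationSubshift (a k)).carrier ⊆ (unionSubshift a).carrier :=
  (subset_iUnion (fun k => (rotationSubshift (a k)).carrier) k).trans subset_closure

theorem words_unionSubshift (a : ℕ → ℝ) (n : ℕ) :
    words (unionSubshift a) n ⊆ ⋃ k, words (rotationSubshift (a k)) n := by
  rintro w ⟨x, hx, m, hw⟩
  obtain ⟨y, hy, hyx⟩ := exists_word_of_mem_closure hx m n
  obtain ⟨k, hk⟩ := mem_iUnion.1 hy
  exact mem_iUnion.2 ⟨k, y, hk, m, fun i => (hyx i).trans (hw i)⟩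

theorem complexity_unionSubshift_le {a : ℕ → ℝ} (ha : ∀ k, a k ∈ Ioo (0 : ℝ) 1)
    (hirr : ∀ k, Irrational (a k)) {n K : ℕ} (hK : ∀ k ≥ K, n * a k ≤ 1) :
    complexity (unionSubshift a) n ≤ (K + 1) * (n + 1) := by
  have hsub : words (unionSubshift a) n ⊆
      (⋃ k ∈ Finset.range K, words (rotationSubshift (a k)) n) ∪ sparseWords n := by
    refine (words_unionSubshift a n).trans (iUnion_subset fun k => ?_)
    by_cases hk : k < K
    · exact (subset_biUnion_of_mem (u := fun k => words (rotationSubshift (a k)) n)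
        (Finset.mem_coe.2 (Finset.mem_range.2 hk))).trans subset_union_left
    · exact (words_subset_sparseWords (ha k) (hK k (by omega))).trans subset_union_right
  have hU : (⋃ k ∈ Finset.range K, words (rotationSubshift (a k)) n).ncard ≤ K * (n + 1) := by
    refine (Finset.set_ncard_biUnion_le _ _).trans ?_
    refine (Finset.sum_le_sum fun k _ =>
      (complexity_rotationSubshift (ha k) (hirr k) n).le).trans ?_
    simp
  calc complexity (unionSubshift a) n ≤ _ := ncard_le_ncard hsub (toFinite _)
    _ ≤ _ := ncard_union_le _ _
    _ ≤ K * (n + 1) + (n + 1) := Nat.add_le_add hU (ncard_sparseWords_le n)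
    _ = (K + 1) * (n + 1) := by ring

theorem infinite_ergodicMeasures_unionSubshift {a : ℕ → ℝ} (ha : ∀ k, a k ∈ Ioo (0 : ℝ) 1)
    (hirr : ∀ k, Irrational (a k)) (hinj : Function.Injective a) :
    {μ : Measure (ℤ → Fin 2) |
      IsErgodicMeasure (unionSubshift a) μ ∧ NullSingletonClass μ}.Infinite := by
  refine infinite_of_injective_forall_mem (f := fun k => rotationMeasure (a k)) ?_ fun k =>
    ⟨isErgodicMeasure_rotationMeasure (hirr k) (rotationSubshift_subset_unionSubshift a k),
      nullSingletonClass_rotationMeasure (ha k) (hirr k)⟩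
  intro k l hkl
  have h := congrArg (fun μ : Measure (ℤ → Fin 2) => μ {x | x 0 = 1}) hkl
  simp only [rotationMeasure_one (ha _)] at h
  exact hinj ((ENNReal.ofReal_eq_ofReal_iff (ha k).1.le (ha l).1.le).1 h)

theorem eventually_mul_le_of_liminf_eq_top {p : ℕ → ℝ}
    (hp : liminf (fun n : ℕ => ((p n / (n : ℝ) : ℝ) : EReal)) atTop = ⊤) (c : ℝ) :
    ∀ᶠ n : ℕ in atTop, c * (n + 1) ≤ p n := by
  -- The 2 absorbs n + 1 ≤ 2n; the absolute value covers negative c.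
  have h : ((2 * |c| : ℝ) : EReal) < liminf (fun n : ℕ => ((p n / (n : ℝ) : ℝ) : EReal)) atTop := by
    rw [hp]; exact EReal.coe_lt_top _
  filter_upwards [eventually_lt_of_lt_liminf h, eventually_ge_atTop 1] with n hn hn1
  have hn1' : (1 : ℝ) ≤ n := by exact_mod_cast hn1
  rw [EReal.coe_lt_coe_iff, lt_div_iff₀ (by linarith)] at hn
  nlinarith [le_abs_self c, abs_nonneg c]

/-! ### Choice of slopes and conclusion -/

/-- The slope `√2 / (2 * (N + 1))`. -/
noncomputable def slope (N : ℕ) : ℝ := √2 / ((2 * (N + 1) : ℕ) : ℝ)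

theorem sqrt_two_lt_two : √2 < 2 := by
  rw [Real.sqrt_lt' (by norm_num)]; norm_num

theorem slope_mem (N : ℕ) : slope N ∈ Ioo (0 : ℝ) 1 := by
  have h : (0 : ℝ) ≤ N := N.cast_nonneg
  refine ⟨by unfold slope; positivity, ?_⟩
  rw [slope, div_lt_one (by positivity)]
  push_cast
  linarith [sqrt_two_lt_two]

theorem irrational_slope (N : ℕ) : Irrational (slope N) :=
  irrational_sqrt_two.div_natCast (by omega)

theorem slope_injective : Function.Injective slope := by
  intro M N h
  have h2 : √2 ≠ 0 := by positivity
  have := (mul_right_inj' h2).1 (by simpa only [slope, div_eq_mul_inv] using h)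
  have := inv_injective this
  have := Nat.cast_injective (R := ℝ) this
  omega

theorem mul_slope_le_one {n N : ℕ} (h : n ≤ N) : n * slope N ≤ 1 := by
  have h' : (n : ℝ) ≤ N := by exact_mod_cast h
  have h0 : (0 : ℝ) ≤ n := n.cast_nonneg
  rw [slope, ← mul_div_assoc, div_le_one (by positivity)]
  push_cast
  nlinarith [sqrt_two_lt_two, Real.sqrt_nonneg 2]

end SymbolicSubshift

open SymbolicSubshift

theorem mainTheorem8 (p : ℕ → ℝ)
    (hp : liminf (fun n : ℕ => ((p n / (n : ℝ) : ℝ) : EReal)) atTop = ⊤) :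
    ∃ X : Subshift (Fin 2) ℤ,
      {μ : Measure (ℤ → Fin 2) |
        SymbolicSubshift.IsErgodicMeasure X μ ∧ NullSingletonClass μ}.Infinite ∧
      (∀ᶠ n : ℕ in atTop, (SymbolicSubshift.complexity X n : ℝ) ≤ p n) ∧
      ∃ S : Set (Subshift (Fin 2) ℤ),
        (∀ Y ∈ S, SymbolicSubshift.IsSturmian Y) ∧
        X.carrier = closure (⋃ Y ∈ S, Y.carrier) := by
  obtain ⟨N, hN, hNp⟩ := extraction_forall_of_eventually'
    (P := fun k M => ∀ n ≥ M, ((k : ℝ) + 1) * (n + 1) ≤ p n) fun k => by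
      obtain ⟨M, hM⟩ := eventually_atTop.1 (eventually_mul_le_of_liminf_eq_top hp (k + 1))
      exact ⟨M, fun l hl n hn => hM n (hl.trans hn)⟩
  -- The index k + 1 makes n * a k ≤ 1 for n ≤ N (k + 1), so on N K ≤ n < N (K + 1) only the first K
  -- slopes can be too large.
  let a : ℕ → ℝ := fun k => slope (N (k + 1))
  have ha : ∀ k, a k ∈ Set.Ioo (0 : ℝ) 1 := fun k => slope_mem _
  have hirr : ∀ k, Irrational (a k) := fun k => irrational_slope _
  have hinj : Function.Injective a := fun k l h => by
    have := hN.injective (slope_injective h)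
    omega
  refine ⟨unionSubshift a, infinite_ergodicMeasures_unionSubshift ha hirr hinj, ?_,
    Set.range fun k => rotationSubshift (a k), ?_, ?_⟩
  · filter_upwards [eventually_ge_atTop (N 0)] with n hn
    have hex : ∃ K, n < N (K + 1) := ⟨n, (Nat.lt_succ_self n).trans_le hN.le_apply⟩
    classical
    obtain ⟨K, hK, hmin⟩ : ∃ K, n < N (K + 1) ∧ N K ≤ n := by
      refine ⟨Nat.find hex, Nat.find_spec hex, ?_⟩
      rcases h : Nat.find hex with _ | K
      -- At K = 0 minimality gives no lower bound; n ≥ N 0 supplies it.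
      · exact hn
      · exact not_lt.1 (Nat.find_min hex (m := K) (by omega))
    have hc := complexity_unionSubshift_le ha hirr (n := n) (K := K) fun k hk =>
      mul_slope_le_one (hK.le.trans (hN.monotone (by omega)))
    refine le_trans ?_ (hNp K n hmin)
    exact_mod_cast hc
  · rintro _ ⟨k, rfl⟩
    exact isSturmian_rotationSubshift (ha k) (hirr k)
  · rw [Set.biUnion_range]
    rfl
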